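/- Let $R_0>1$, $R_c>0$ and $R_1=R_0+R_c$. Let $(N_t)_{t\ge 0}$ and $(N^c_t)_{t\ge 0}$ be independent Poisson processes of rates $R_0$ (arrivals from the free server) and $R_c$ (arrivals from the costly server). For a deterministic (off-line) policy $u:[0,\infty)\to\{0,1\}$ and an initial buffer size $D$, let the buffer size be $$x_t = D + N_t + \int_{(0,t]} u_\tau\, dN^c_\tau - t ,\qquad t\ge 0 .$$ The file is infinite, so an interruption occurs exactly when $\tau_e=\inf\{t\ge 0: x_t\le 0\}<\infty$. For $\epsilon>0$, the policy is called $(D,\epsilon)$-feasible if $\Pr\{\tau_e<\infty\}\le\epsilon$. (For a file of size $F$, interruption means $\tau_e<\tau_f$ with $\tau_f=\inf\{t\ge 0: x_t\ge F-t\}$, and $\tau_f=\infty$ when $F=\infty$.) For $R>1$ let $\bar r(R)=\sup\{r\in\mathbb R: r+R(e^{-r}-1)=0\}$, put $\alpha_0=\bar r(R_0)$, $\alpha_1=\bar r(R_1)$, and $$\mathcal R=\Big\{(D,\epsilon):\ \epsilon>0,\ \tfrac1{\alpha_1}\log\tfrac1\epsilon\le D\le \tfrac1{\alpha_0}\log\tfrac1\epsilon\Big\}.$$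 For $t_s\in[0,\infty]$ consider the off-line policy that uses both servers up to time $t_s$ and only the free server afterwards: $u_t=1$ if $t\le t_s$, and $u_t=0$ if $t>t_s$. **Theorem.** For every $(D,\epsilon)\in\mathcal R$, this policy is $(D,\epsilon)$-feasible whenever $$t_s\ \ge\ t_s^* = \frac{R_0}{R_1-R_0}\left[\frac1{\alpha_0}\log\frac1{\epsilon-e^{-\alpha_1 D}}-D\right],$$ where $t_s^*=\infty$ if $\epsilon=e^{-\alpha_1 D}$ (i.e. $\log(1/0)=\infty$). -/

import Mathlib

open MeasureTheory ProbabilityTheory Set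
open scoped NNReal ENNReal

noncomputable section

namespace Streaming

/-- A counting process on `[0, ∞)`: an `ℕ`-valued process started at `0` whose paths are
nondecreasing and right-continuous. -/
structure CountingProcess (Ω : Type*) [MeasurableSpace Ω] where
  /-- the number of arrivals in `(0, t]` -/
  toFun : ℝ≥0 → Ω → ℕ
  measurable' : ∀ t, Measurable (toFun t)
  zero' : ∀ ω, toFun 0 ω = 0
  mono' : ∀ ω, Monotone fun t => toFun t ω
  right_continuous' : ∀ ω t, ContinuousWithinAt (fun s => toFun s ω) (Ici t) t

namespace CountingProcess

variable {Ω : Type*} [MeasurableSpace Ω]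

instance : CoeFun (CountingProcess Ω) fun _ => ℝ≥0 → Ω → ℕ := ⟨toFun⟩

/-- The path of a counting process as a right-continuous nondecreasing real function, so that
`(N.path ω).measure` is the random measure `dN(ω)` on `[0, ∞)`. -/
def path (N : CountingProcess Ω) (ω : Ω) : StieltjesFunction ℝ≥0 where
  toFun t := (N t ω : ℝ)
  mono' := fun _ _ h => Nat.cast_le.2 (N.mono' ω h)
  right_continuous' := fun t =>
    (continuous_of_discreteTopology (f := fun n : ℕ => (n : ℝ))).continuousAt.comp_continuousWithinAt
      (N.right_continuous' ω t)

/-- `N` is a (homogeneous) Poisson process of rate `r` under `P`: it has independent increments,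
and the increment over `(s, t]` has the Poisson law of mean `r * (t - s)`. -/
structure IsPoisson (N : CountingProcess Ω) (r : ℝ≥0) (P : Measure Ω) : Prop where
  indep_increments : HasIndepIncrements N.toFun P
  increment_law : ∀ s t : ℝ≥0, s ≤ t →
    HasLaw (fun ω => N t ω - N s ω) (poissonMeasure (r * (t - s))) P

end CountingProcess

variable {Ω : Type*} [MeasurableSpace Ω]

/-- An off-line policy: a deterministic function of time with values in `{0, 1}`;
`0` means that only the free server is used, `1` that both servers are used. -/
abbrev OfflinePolicy := ℝ≥0 → Fin 2

/-- The off-line policy `u_t = 1` if `t ≤ t_s` and `u_t = 0` if `t > t_s`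
(for `t_s = ∞` both servers are used forever). -/
def thresholdPolicy (ts : ℝ≥0∞) : OfflinePolicy :=
  fun t => if (t : ℝ≥0∞) ≤ ts then 1 else 0

/-- The buffer size `x_t = D + N_t + ∫_{(0, t]} u_τ dN^c_τ - t`. -/
def buffer (N Nc : CountingProcess Ω) (u : OfflinePolicy) (D : ℝ) (t : ℝ≥0) (ω : Ω) : ℝ :=
  D + N t ω + ∫ τ in Ioc 0 t, ((u τ : ℕ) : ℝ) ∂(Nc.path ω).measure - t

/-- `τ_e = inf {t ≥ 0 : x_t ≤ 0}`, with `inf ∅ = ∞`. -/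
def emptyTime (N Nc : CountingProcess Ω) (u : OfflinePolicy) (D : ℝ) (ω : Ω) : ℝ≥0∞ :=
  ⨅ (t : ℝ≥0) (_ : buffer N Nc u D t ω ≤ 0), (t : ℝ≥0∞)

/-- `τ_f = inf {t ≥ 0 : x_t ≥ F - t}`, with `inf ∅ = ∞`, for a file of size `F ∈ [0, ∞]`. -/
def finishTime (F : ℝ≥0∞) (N Nc : CountingProcess Ω) (u : OfflinePolicy) (D : ℝ) (ω : Ω) :
    ℝ≥0∞ :=
  ⨅ (t : ℝ≥0) (_ : (F : EReal) - ((t : ℝ) : EReal) ≤ (buffer N Nc u D t ω : EReal)), (t : ℝ≥0∞)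

/-- The interruption probability `p(D) = P(τ_e < τ_f)`. -/
def interruptionProb (P : Measure Ω) (F : ℝ≥0∞) (N Nc : CountingProcess Ω) (u : OfflinePolicy)
    (D : ℝ) : ℝ :=
  P.real {ω | emptyTime N Nc u D ω < finishTime F N Nc u D ω}

/-- `(D, ε)`-feasibility of a policy: the interruption probability is at most `ε`. -/
def IsFeasible (P : Measure Ω) (F : ℝ≥0∞) (N Nc : CountingProcess Ω) (D ε : ℝ)
    (u : OfflinePolicy) : Prop :=
  interruptionProb P F N Nc u D ≤ ε

/-- `γ(r) = r + R (e^{-r} - 1)`. -/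
def gammaFun (R r : ℝ) : ℝ := r + R * (Real.exp (-r) - 1)

/-- The largest root `sup {r : γ(r) = 0}` of `γ`. -/
def rBar (R : ℝ) : ℝ := sSup {r : ℝ | gammaFun R r = 0}

/-- The region of pairs `(D, ε)`, `ε > 0`, with
`(1/α₁) log (1/ε) ≤ D ≤ (1/α₀) log (1/ε)`, where `αᵢ` is the largest root for the rate `Rᵢ`. -/
def region (R₀ R₁ : ℝ) : Set (ℝ × ℝ) :=
  {p | 0 < p.2 ∧ 1 / rBar R₁ * Real.log (1 / p.2) ≤ p.1 ∧
    p.1 ≤ 1 / rBar R₀ * Real.log (1 / p.2)}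

/-- `t_s* = (R₀ / (R₁ - R₀)) [(1/α₀) log (1 / (ε - e^{-α₁ D})) - D]`, with the convention
`log (1 / 0) = ∞`, so that `t_s* = ∞` when `ε = e^{-α₁ D}` (on the lower boundary of the region;
`ε < e^{-α₁ D}` does not occur in the region). -/
def tsStar (R₀ R₁ D ε : ℝ) : EReal :=
  if Real.exp (-(rBar R₁) * D) < ε then
    ((R₀ / (R₁ - R₀) *
      (1 / rBar R₀ * Real.log (1 / (ε - Real.exp (-(rBar R₁) * D))) - D) : ℝ) : EReal)
  else ⊤

end Streaming

end

/-! Under the threshold policy with finite `ts = a`, the costly count is frozen after time `a`. An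
empty buffer before `a` is an empty buffer for the policy that always uses both servers, which has
probability at most `exp (-α₁ D)`. An empty buffer after `a` concerns a free-server walk whose
exponential supermartingale with exponent `α₀` is started at time `a`; its probability is at most
`exp (-α₀ (D + a Rc / R₀))`. The threshold `tsStar` is the `a` at which the two bounds add up to
`ε`.

Both bounds are cases of `measure_exists_le_zero_le`: Ville's inequality for products of independent
exponential increments on a time grid, followed by a limit in the mesh. -/

namespace Streaming

/-! ### Ville's inequality for products -/

section Ville

variable {Ω : Type*} {mΩ : MeasurableSpace Ω}

/-- The partial products `c * g 0 * ⋯ * g n`, stopped as soon as they reach the level `1`. -/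
noncomputable def stoppedProd (c : ℝ≥0∞) (g : ℕ → Ω → ℝ≥0∞) : ℕ → Ω → ℝ≥0∞
  | 0 => fun ω => c * g 0 ω
  | n + 1 => fun ω =>
      {ω | 1 ≤ stoppedProd c g n ω}.indicator (stoppedProd c g n) ω +
        {ω | 1 ≤ stoppedProd c g n ω}ᶜ.indicator (stoppedProd c g n) ω * g (n + 1) ω

variable {c : ℝ≥0∞} {g : ℕ → Ω → ℝ≥0∞}

lemma stoppedProd_succ_of_one_le {n : ℕ} {ω : Ω} (h : 1 ≤ stoppedProd c g n ω) :
    stoppedProd c g (n + 1) ω = stoppedProd c g n ω := by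
  simp [stoppedProd, h]

lemma stoppedProd_succ_of_lt_one {n : ℕ} {ω : Ω} (h : ¬ 1 ≤ stoppedProd c g n ω) :
    stoppedProd c g (n + 1) ω = stoppedProd c g n ω * g (n + 1) ω := by
  simp [stoppedProd, h]

lemma stoppedProd_eq_or_one_le (n : ℕ) (ω : Ω) :
    stoppedProd c g n ω = c * ∏ i ∈ Finset.range (n + 1), g i ω ∨ 1 ≤ stoppedProd c g n ω := by
  induction n with
  | zero => simp [stoppedProd]
  | succ n ih =>
    by_cases h : 1 ≤ stoppedProd c g n ω
    · exact .inr (by rwa [stoppedProd_succ_of_one_le h])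
    · left
      rw [stoppedProd_succ_of_lt_one h, ih.resolve_right h, Finset.prod_range_succ _ (n + 1),
        mul_assoc]

lemma measurable_stoppedProd {ℱ : Filtration ℕ mΩ} (hg : ∀ n, Measurable[ℱ n] (g n)) (n : ℕ) :
    Measurable[ℱ n] (stoppedProd c g n) := by
  induction n with
  | zero => exact (hg 0).const_mul c
  | succ n ih =>
    have ih' : Measurable[ℱ (n + 1)] (stoppedProd c g n) := ih.mono (ℱ.mono n.le_succ) le_rfl
    have hs : MeasurableSet[ℱ (n + 1)] {ω | 1 ≤ stoppedProd c g n ω} := ih' measurableSet_Ici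
    exact (ih'.indicator hs).add ((ih'.indicator hs.compl).mul (hg (n + 1)))

/-- Where the product is frozen nothing changes; elsewhere it is multiplied by a factor independent
of the past with mean at most `1`. The factor `g 0` is unrestricted and supplies the bound. -/
lemma lintegral_stoppedProd_le {P : Measure Ω} {ℱ : Filtration ℕ mΩ}
    (hg : ∀ n, Measurable[ℱ n] (g n))
    (hind : ∀ n, Indep (ℱ n) (MeasurableSpace.comap (g (n + 1)) inferInstance) P)
    (hle : ∀ n, ∫⁻ ω, g (n + 1) ω ∂P ≤ 1) (n : ℕ) :
    ∫⁻ ω, stoppedProd c g n ω ∂P ≤ c * ∫⁻ ω, g 0 ω ∂P := by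
  have hgm : ∀ n, Measurable (g n) := fun n => (hg n).mono (ℱ.le n) le_rfl
  induction n with
  | zero => exact (lintegral_const_mul c (hgm 0)).le
  | succ n ih =>
    refine le_trans ?_ ih
    have hV := measurable_stoppedProd (c := c) hg n
    have hs : MeasurableSet[ℱ n] {ω | 1 ≤ stoppedProd c g n ω} := hV measurableSet_Ici
    have hs' := ℱ.le n _ hs
    have hV' := hV.mono (ℱ.le n) le_rfl
    change ∫⁻ ω, ({ω | 1 ≤ stoppedProd c g n ω}.indicator (stoppedProd c g n) ω +
        {ω | 1 ≤ stoppedProd c g n ω}ᶜ.indicator (stoppedProd c g n) ω * g (n + 1) ω) ∂P ≤ _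
    rw [lintegral_add_left (hV'.indicator hs'),
      lintegral_mul_eq_lintegral_mul_lintegral_of_independent_measurableSpace (ℱ.le n)
        (hgm (n + 1)).comap_le (hind n) (hV.indicator hs.compl) (comap_measurable _),
      lintegral_indicator hs', lintegral_indicator hs'.compl,
      ← lintegral_add_compl (μ := P) (stoppedProd c g n) hs']
    exact add_le_add le_rfl (mul_le_of_le_one_right' (hle n))

/-- **Ville's inequality** for products of factors of mean at most `1`, each independent of the
past. -/
theorem measure_exists_one_le_prod_le {P : Measure Ω} {ℱ : Filtration ℕ mΩ}
    (hg : ∀ n, Measurable[ℱ n] (g n))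
    (hind : ∀ n, Indep (ℱ n) (MeasurableSpace.comap (g (n + 1)) inferInstance) P)
    (hle : ∀ n, ∫⁻ ω, g (n + 1) ω ∂P ≤ 1) :
    P {ω | ∃ n, 1 ≤ c * ∏ i ∈ Finset.range (n + 1), g i ω} ≤ c * ∫⁻ ω, g 0 ω ∂P := by
  have hsub : {ω | ∃ n, 1 ≤ c * ∏ i ∈ Finset.range (n + 1), g i ω} ⊆
      ⋃ n, {ω | 1 ≤ stoppedProd c g n ω} := by
    rintro ω ⟨n, hn⟩
    refine mem_iUnion.2 ⟨n, ?_⟩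
    rcases stoppedProd_eq_or_one_le (c := c) (g := g) n ω with h | h
    · exact hn.trans_eq h.symm
    · exact h
  -- Freezing makes the level sets increase, so Markov's inequality at each fixed `n` bounds their
  -- union.
  have hmono : Monotone fun n => {ω | 1 ≤ stoppedProd c g n ω} :=
    monotone_nat_of_le_succ fun n ω h => h.trans_eq (stoppedProd_succ_of_one_le h).symm
  refine (measure_mono hsub).trans ?_
  rw [hmono.measure_iUnion]
  refine iSup_le fun n => ?_
  have hV := (measurable_stoppedProd (c := c) hg n).mono (ℱ.le n) le_rfl
  have := mul_meas_ge_le_lintegral (μ := P) hV 1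
  rw [one_mul] at this
  exact this.trans (lintegral_stoppedProd_le hg hind hle n)

/-- Two independent families of independent random variables form an independent family. -/
lemma iIndepFun_sumElim {ι κ β : Type*} [MeasurableSpace β] {P : Measure Ω}
    {a : ι → Ω → β} {b : κ → Ω → β} (ha : iIndepFun a P) (hb : iIndepFun b P)
    (hab : IndepFun (fun ω i => a i ω) (fun ω j => b j ω) P) :
    iIndepFun (Sum.elim a b) P := by
  rw [iIndepFun_iff_measure_inter_preimage_eq_mul] at ha hb ⊢
  intro S sets hS
  rw [← Finset.toLeft_disjSum_toRight (u := S), Finset.prod_disjSum]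
  have hl : ∀ i ∈ S.toLeft, MeasurableSet (sets (.inl i)) :=
    fun i hi => hS _ (Finset.mem_toLeft.1 hi)
  have hr : ∀ j ∈ S.toRight, MeasurableSet (sets (.inr j)) :=
    fun j hj => hS _ (Finset.mem_toRight.1 hj)
  have key := hab.measure_inter_preimage_eq_mul
    (⋂ i ∈ S.toLeft, (fun x : ι → β => x i) ⁻¹' sets (.inl i))
    (⋂ j ∈ S.toRight, (fun x : κ → β => x j) ⁻¹' sets (.inr j))
    (Finset.measurableSet_biInter _ fun i hi => measurable_pi_apply i (hl i hi))
    (Finset.measurableSet_biInter _ fun j hj => measurable_pi_apply j (hr j hj))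
  simp only [preimage_iInter, preimage_preimage] at key
  simp only [Sum.elim_inl, Sum.elim_inr]
  rw [← ha S.toLeft hl, ← hb S.toRight hr]
  refine Eq.trans (congrArg P ?_) key
  ext ω
  simp [Sum.forall]

end Ville

/-! ### Poisson Laplace transform and the root of `gammaFun` -/

lemma lintegral_exp_neg_poissonMeasure (r : ℝ≥0) (α : ℝ) :
    ∫⁻ n : ℕ, ENNReal.ofReal (Real.exp (-α * n)) ∂poissonMeasure r =
      ENNReal.ofReal (Real.exp (r * (Real.exp (-α) - 1))) := by
  have hsum : HasSum (fun n : ℕ => Real.exp (-r) * r ^ n / n.factorial * Real.exp (-α * n))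
      (Real.exp (r * (Real.exp (-α) - 1))) := by
    have h := (NormedSpace.expSeries_div_hasSum_exp (r * Real.exp (-α) : ℝ)).mul_left
      (Real.exp (-r))
    rw [← Real.exp_eq_exp_ℝ, ← Real.exp_add] at h
    convert! h using 1
    · ext n
      rw [mul_pow, ← Real.exp_nat_mul, mul_comm (n : ℝ)]
      ring
    · ring_nf
  rw [poissonMeasure, lintegral_sum_measure, ← hsum.tsum_eq,
    ENNReal.ofReal_tsum_of_nonneg (fun n => by positivity) hsum.summable]
  congr 1 with n
  rw [lintegral_smul_measure, lintegral_dirac, smul_eq_mul, ← ENNReal.ofReal_mul (by positivity)]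

section Root

variable {R : ℝ}

lemma gammaFun_rBar (hR : 0 ≤ R) : gammaFun R (rBar R) = 0 := by
  have hc : Continuous (gammaFun R) := by unfold gammaFun; fun_prop
  refine (isClosed_eq hc continuous_const : IsClosed {r | gammaFun R r = 0}).csSup_mem
    ⟨0, by simp [gammaFun]⟩ ⟨R, fun r (hr : gammaFun R r = 0) => ?_⟩
  unfold gammaFun at hr
  nlinarith [mul_nonneg hR (Real.exp_pos (-r)).le]

/-- Since `R ≤ exp (R - 1)`, `gammaFun R` changes sign on `[R - 1, R]`, which gives a positive root;
every root is at most `R`. -/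
lemma rBar_pos (hR : 1 < R) : 0 < rBar R := by
  have hc : Continuous (gammaFun R) := by unfold gammaFun; fun_prop
  have hlo : gammaFun R (R - 1) ≤ 0 := by
    have h1 : R * Real.exp (-(R - 1)) ≤ 1 := by
      rw [Real.exp_neg, ← div_eq_mul_inv, div_le_one (Real.exp_pos _)]
      linarith [Real.add_one_le_exp (R - 1)]
    unfold gammaFun
    linarith
  have hhi : 0 ≤ gammaFun R R := by
    unfold gammaFun
    nlinarith [Real.exp_pos (-R)]
  obtain ⟨r, ⟨hr, -⟩, h0⟩ := intermediate_value_Icc (by linarith : R - 1 ≤ R) hc.continuousOn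
    ⟨hlo, hhi⟩
  have hbdd : BddAbove {r | gammaFun R r = 0} := ⟨R, fun r (hr : gammaFun R r = 0) => by
    unfold gammaFun at hr
    nlinarith [Real.exp_pos (-r)]⟩
  exact lt_of_lt_of_le (by linarith) (le_csSup hbdd h0)

end Root

/-! ### Crossing bounds for the two Poisson processes -/

section Crossing

variable {Ω : Type*} {mΩ : MeasurableSpace Ω}

/-- Ville's inequality for products of functions of two independent sequences of independent
variables. -/
lemma measure_exists_one_le_prod_le_of_indepFun {P : Measure Ω} [IsProbabilityMeasure P]
    {a b : ℕ → Ω → ℕ} (ham : ∀ n, Measurable (a n)) (hbm : ∀ n, Measurable (b n))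
    (ha : iIndepFun a P) (hb : iIndepFun b P)
    (hab : IndepFun (fun ω i => a i ω) (fun ω i => b i ω) P) (φ ψ : ℕ → ℕ → ℝ≥0∞)
    (hle : ∀ n, (∫⁻ ω, φ (n + 1) (a (n + 1) ω) ∂P) * ∫⁻ ω, ψ (n + 1) (b (n + 1) ω) ∂P ≤ 1) :
    P {ω | ∃ n, 1 ≤ ∏ i ∈ Finset.range (n + 1), (φ i (a i ω) * ψ i (b i ω))} ≤
      (∫⁻ ω, φ 0 (a 0 ω) ∂P) * ∫⁻ ω, ψ 0 (b 0 ω) ∂P := by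
  have hi := iIndepFun_sumElim ha hb hab
  have hm : ∀ x, Measurable (Sum.elim a b x) := Sum.forall.2 ⟨ham, hbm⟩
  have hmul : ∀ n, ∫⁻ ω, φ n (a n ω) * ψ n (b n ω) ∂P =
      (∫⁻ ω, φ n (a n ω) ∂P) * ∫⁻ ω, ψ n (b n ω) ∂P := fun n =>
    lintegral_mul_eq_lintegral_mul_lintegral_of_indepFun
      ((measurable_of_countable (φ n)).comp (ham n)) ((measurable_of_countable (ψ n)).comp (hbm n))
      ((hab.comp (measurable_pi_apply n) (measurable_pi_apply n)).comp
        (measurable_of_countable (φ n)) (measurable_of_countable (ψ n)))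
  let m : ℕ ⊕ ℕ → MeasurableSpace Ω := fun x => MeasurableSpace.comap (Sum.elim a b x) inferInstance
  have hmle : ∀ x, m x ≤ mΩ := fun x => (hm x).comap_le
  -- The past at `n` is generated by both sequences up to index `n`; the next factor uses a disjoint
  -- set of indices.
  let ℱ : Filtration ℕ mΩ :=
    { seq := fun n => ⨆ x ∈ {x : ℕ ⊕ ℕ | Sum.elim id id x ≤ n}, m x
      mono' := fun i j hij => biSup_mono fun x hx => le_trans hx hij
      le' := fun n => iSup₂_le fun x _ => hmle x }
  have hmeas : ∀ (S : Set (ℕ ⊕ ℕ)) (n : ℕ), .inl n ∈ S → .inr n ∈ S →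
      Measurable[⨆ x ∈ S, m x] fun ω => φ n (a n ω) * ψ n (b n ω) := by
    intro S n hl hr
    have h1 : Measurable[⨆ x ∈ S, m x] (a n) :=
      (comap_measurable (a n)).mono (le_biSup m hl) le_rfl
    have h2 : Measurable[⨆ x ∈ S, m x] (b n) :=
      (comap_measurable (b n)).mono (le_biSup m hr) le_rfl
    exact ((measurable_of_countable (φ n)).comp h1).mul ((measurable_of_countable (ψ n)).comp h2)
  have key := measure_exists_one_le_prod_le (c := 1) (P := P) (ℱ := ℱ)
    (g := fun n ω => φ n (a n ω) * ψ n (b n ω)) (fun n => hmeas _ n (by simp) (by simp)) ?_ ?_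
  · simpa only [one_mul, hmul] using key
  · intro n
    have hd : Disjoint {x : ℕ ⊕ ℕ | Sum.elim id id x ≤ n}
        {x : ℕ ⊕ ℕ | Sum.elim id id x = n + 1} :=
      disjoint_left.2 fun x (h1 : _ ≤ n) (h2 : _ = n + 1) => by omega
    exact indep_of_indep_of_le_right (indep_iSup_of_disjoint hmle hi hd)
      (hmeas _ (n + 1) (by simp) (by simp)).comap_le
  · intro n
    exact (hmul (n + 1)).trans_le (hle n)

variable {P : Measure Ω} {N Nc : CountingProcess Ω} {R₀ Rc : ℝ≥0}

lemma CountingProcess.IsPoisson.lintegral_exp_neg {r : ℝ≥0} (hN : N.IsPoisson r P) {s t : ℝ≥0}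
    (hst : s ≤ t) (α : ℝ) :
    ∫⁻ ω, ENNReal.ofReal (Real.exp (-α * (N t ω - N s ω : ℕ))) ∂P =
      ENNReal.ofReal (Real.exp (r * (t - s) * (Real.exp (-α) - 1))) := by
  have h := lintegral_exp_neg_poissonMeasure (r * (t - s)) α
  have hlaw := hN.increment_law s t hst
  rw [← hlaw.map_eq, lintegral_map' (by fun_prop) hlaw.aemeasurable] at h
  rw [h, NNReal.coe_mul, NNReal.coe_sub hst]

/-- Discrete-time exponential bound for the free process sampled at times `t n` together with the
costly process sampled at times `s n`. -/
lemma measure_exists_grid_le [IsProbabilityMeasure P] (hN : N.IsPoisson R₀ P)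
    (hNc : Nc.IsPoisson Rc P) (hind : IndepFun (fun ω t => N t ω) (fun ω t => Nc t ω) P)
    {t s : ℕ → ℝ≥0} (ht : Monotone t) (hs : Monotone s) (ht0 : t 0 = 0) (hs0 : s 0 = 0)
    {α : ℝ} (hα : 0 ≤ α) (y : ℝ)
    (hstep : ∀ n, α * (t (n + 2) - t (n + 1)) + (R₀ * (t (n + 2) - t (n + 1)) +
      Rc * (s (n + 2) - s (n + 1))) * (Real.exp (-α) - 1) ≤ 0) :
    P {ω | ∃ n, (N (t (n + 1)) ω + Nc (s (n + 1)) ω - t (n + 1) : ℝ) ≤ y} ≤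
      ENNReal.ofReal (Real.exp (α * y + α * t 1 +
        (R₀ * t 1 + Rc * s 1) * (Real.exp (-α) - 1))) := by
  -- The level `y` is loaded into factor `0`, the only one whose mean may exceed `1`.
  let k : ℕ → ℝ := fun n => α * (t (n + 1) - t n) + if n = 0 then α * y else 0
  let φ : ℕ → ℕ → ℝ≥0∞ := fun n x =>
    ENNReal.ofReal (Real.exp (k n)) * ENNReal.ofReal (Real.exp (-α * x))
  let ψ : ℕ → ℕ → ℝ≥0∞ := fun _ x => ENNReal.ofReal (Real.exp (-α * x))
  have hint : ∀ n, (∫⁻ ω, φ n (N (t (n + 1)) ω - N (t n) ω) ∂P) *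
      ∫⁻ ω, ψ n (Nc (s (n + 1)) ω - Nc (s n) ω) ∂P =
      ENNReal.ofReal (Real.exp (k n + (R₀ * (t (n + 1) - t n) +
        Rc * (s (n + 1) - s n)) * (Real.exp (-α) - 1))) := by
    intro n
    simp only [φ, ψ]
    rw [lintegral_const_mul' _ _ ENNReal.ofReal_ne_top, hN.lintegral_exp_neg (ht n.le_succ),
      hNc.lintegral_exp_neg (hs n.le_succ), ← ENNReal.ofReal_mul (by positivity),
      ← ENNReal.ofReal_mul (by positivity), ← Real.exp_add, ← Real.exp_add]
    congr 2
    ring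
  have hprod : ∀ n ω, ∏ i ∈ Finset.range (n + 1), (φ i (N (t (i + 1)) ω - N (t i) ω) *
      ψ i (Nc (s (i + 1)) ω - Nc (s i) ω)) = ENNReal.ofReal (Real.exp
        (α * (y - (N (t (n + 1)) ω + Nc (s (n + 1)) ω - t (n + 1))))) := by
    intro n ω
    have hterm : ∀ i, φ i (N (t (i + 1)) ω - N (t i) ω) * ψ i (Nc (s (i + 1)) ω - Nc (s i) ω) =
        ENNReal.ofReal (Real.exp (k i - α * (N (t (i + 1)) ω - N (t i) ω) -
          α * (Nc (s (i + 1)) ω - Nc (s i) ω))) := by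
      intro i
      simp only [φ, ψ]
      rw [← ENNReal.ofReal_mul (by positivity), ← ENNReal.ofReal_mul (by positivity),
        ← Real.exp_add, ← Real.exp_add, Nat.cast_sub (N.mono' ω (ht i.le_succ)),
        Nat.cast_sub (Nc.mono' ω (hs i.le_succ))]
      congr 2
      ring
    induction n with
    | zero =>
      rw [zero_add, Finset.prod_range_one, hterm]
      simp only [k, zero_add, if_true, ht0, hs0, N.zero', Nc.zero', NNReal.coe_zero, Nat.cast_zero]
      congr 2
      ring
    | succ n ih =>
      rw [Finset.prod_range_succ, ih, hterm, ← ENNReal.ofReal_mul (by positivity), ← Real.exp_add]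
      simp only [k, Nat.succ_ne_zero, if_false]
      congr 2
      ring
  have hmeas : ∀ (M : CountingProcess Ω) (u v : ℝ≥0), Measurable fun ω => M u ω - M v ω :=
    fun M u v => (M.measurable' u).sub (M.measurable' v)
  have hpi : ∀ u : ℕ → ℝ≥0, Measurable fun (x : ℝ≥0 → ℕ) (i : ℕ) => x (u (i + 1)) - x (u i) :=
    fun u => measurable_pi_lambda _ fun i =>
      (measurable_pi_apply (u (i + 1))).sub (measurable_pi_apply (u i))
  have key := measure_exists_one_le_prod_le_of_indepFun (P := P)
    (a := fun n ω => N (t (n + 1)) ω - N (t n) ω) (b := fun n ω => Nc (s (n + 1)) ω - Nc (s n) ω)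
    (fun n => hmeas N _ _) (fun n => hmeas Nc _ _) (hN.indep_increments.nat ht)
    (hNc.indep_increments.nat hs) (hind.comp (hpi t) (hpi s)) φ ψ ?_
  · rw [hint 0] at key
    refine (measure_mono ?_).trans (key.trans_eq ?_)
    · rintro ω ⟨n, hn⟩
      refine ⟨n, ?_⟩
      rw [hprod, ENNReal.one_le_ofReal, Real.one_le_exp_iff]
      exact mul_nonneg hα (sub_nonneg.2 hn)
    · simp only [k, ht0, hs0, NNReal.coe_zero, if_true, zero_add]
      congr 2
      ring
  · intro n
    rw [hint (n + 1), ENNReal.ofReal_le_one, Real.exp_le_one_iff]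
    simpa [k] using hstep n

/-- Continuous-time exponential bound from time `a` on, where after time `a` the clock of the
costly process runs at speed `κ`. -/
lemma measure_exists_le_zero_le [IsProbabilityMeasure P] (hN : N.IsPoisson R₀ P)
    (hNc : Nc.IsPoisson Rc P) (hind : IndepFun (fun ω t => N t ω) (fun ω t => Nc t ω) P)
    (a κ : ℝ≥0) {α : ℝ} (hα : 0 ≤ α) (D : ℝ)
    (hle : α + (R₀ + κ * Rc) * (Real.exp (-α) - 1) ≤ 0) :
    P {ω | ∃ r : ℝ≥0, (D + N (a + r) ω + Nc (a + κ * r) ω - (a + r) : ℝ) ≤ 0} ≤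
      ENNReal.ofReal (Real.exp (-α * D + α * a + (R₀ + Rc) * a * (Real.exp (-α) - 1))) := by
  have hδ : ∀ δ : ℝ≥0, 0 < δ →
      P {ω | ∃ r : ℝ≥0, (D + N (a + r) ω + Nc (a + κ * r) ω - (a + r) : ℝ) ≤ 0} ≤
      ENNReal.ofReal (Real.exp (α * (δ - D) + α * a +
        (R₀ * a + Rc * a) * (Real.exp (-α) - 1))) := by
    intro δ hδ
    -- The first step jumps from `0` to `a`; later steps have length `c * δ`, with `c = 1` for the
    -- free clock and `c = κ` for the costly one.
    let u : ℝ≥0 → ℕ → ℝ≥0 := fun c n => Nat.casesOn n 0 fun m => a + c * (m * δ)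
    have hu : ∀ c, Monotone (u c) := by
      refine fun c => monotone_nat_of_le_succ fun n => ?_
      cases n with
      | zero => exact zero_le
      | succ n =>
        simp only [u]
        gcongr
        exact n.le_succ
    -- Rounding `r` down to the grid does not increase the counts and moves time back by less than
    -- `δ`, hence the level `δ - D`.
    have key := measure_exists_grid_le hN hNc hind (hu 1) (hu κ) rfl rfl hα (δ - D) ?_
    · have hu1 : ∀ c, u c 1 = a := fun c => by simp [u]
      rw [hu1, hu1] at key
      simp only [u, one_mul] at key
      refine (measure_mono ?_).trans key
      rintro ω ⟨r, hr⟩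
      have h1 : ((⌊r / δ⌋₊ : ℕ) : ℝ≥0) * δ ≤ r :=
        (le_div_iff₀ hδ).1 (Nat.floor_le zero_le)
      have h2 : r < ((⌊r / δ⌋₊ : ℕ) + 1) * δ := (div_lt_iff₀ hδ).1 (Nat.lt_floor_add_one _)
      refine ⟨⌊r / δ⌋₊, ?_⟩
      have h3 : (N (a + (⌊r / δ⌋₊ : ℕ) * δ) ω : ℝ) ≤ N (a + r) ω :=
        Nat.cast_le.2 (N.mono' ω (add_le_add le_rfl h1))
      have h4 : (Nc (a + κ * ((⌊r / δ⌋₊ : ℕ) * δ)) ω : ℝ) ≤ Nc (a + κ * r) ω :=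
        Nat.cast_le.2 (Nc.mono' ω (add_le_add le_rfl (mul_le_mul_right h1 κ)))
      have h5 : (r : ℝ) < ((⌊r / δ⌋₊ : ℕ) + 1) * δ := by exact_mod_cast h2
      push_cast
      linarith
    · intro n
      simp only [u]
      push_cast
      have : (0 : ℝ) ≤ δ := δ.2
      nlinarith
  have hlim : Filter.Tendsto (fun δ : ℝ≥0 => ENNReal.ofReal (Real.exp (α * (δ - D) + α * a +
      (R₀ * a + Rc * a) * (Real.exp (-α) - 1)))) (nhdsWithin 0 (Ioi 0))
      (nhds (ENNReal.ofReal (Real.exp (α * ((0 : ℝ≥0) - D) + α * a +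
        (R₀ * a + Rc * a) * (Real.exp (-α) - 1))))) := by
    refine (Continuous.tendsto ?_ _).mono_left nhdsWithin_le_nhds
    exact ENNReal.continuous_ofReal.comp (by fun_prop)
  refine (ge_of_tendsto hlim (eventually_nhdsWithin_of_forall fun δ => hδ δ)).trans_eq ?_
  congr 2
  push_cast
  ring

end Crossing

/-! ### The buffer under a threshold policy -/

section Buffer

variable {Ω : Type*} [MeasurableSpace Ω] {N Nc : CountingProcess Ω}

lemma setIntegral_thresholdPolicy (ts : ℝ≥0∞) (t : ℝ≥0) (ω : Ω) :
    ∫ τ in Ioc 0 t, ((thresholdPolicy ts τ : ℕ) : ℝ) ∂(Nc.path ω).measure =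
      Nc (min (t : ℝ≥0∞) ts).toNNReal ω := by
  set v : ℝ≥0 := (min (t : ℝ≥0∞) ts).toNNReal with hv
  have hv' : (v : ℝ≥0∞) = min (t : ℝ≥0∞) ts :=
    ENNReal.coe_toNNReal (ne_top_of_le_ne_top ENNReal.coe_ne_top (min_le_left _ _))
  have hfun : EqOn (fun τ => ((thresholdPolicy ts τ : ℕ) : ℝ))
      ((Iic v).indicator fun _ => (1 : ℝ)) (Ioc 0 t) := by
    intro τ hτ
    have hiff : τ ≤ v ↔ (τ : ℝ≥0∞) ≤ ts := by
      rw [← ENNReal.coe_le_coe, hv', le_min_iff, ENNReal.coe_le_coe]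
      exact and_iff_right hτ.2
    by_cases h : (τ : ℝ≥0∞) ≤ ts
    · simp [thresholdPolicy, h, hiff.2 h]
    · simp [thresholdPolicy, h, mt hiff.1 h]
  have hvt : v ≤ t := by
    rw [← ENNReal.coe_le_coe, hv']
    exact min_le_left _ _
  have hset : Ioc 0 t ∩ Iic v = Ioc 0 v := by
    ext τ
    simp only [mem_inter_iff, mem_Ioc, mem_Iic]
    exact ⟨fun h => ⟨h.1.1, h.2⟩, fun h => ⟨⟨h.1, h.2.trans hvt⟩, h.2⟩⟩
  rw [setIntegral_congr_fun measurableSet_Ioc hfun, setIntegral_indicator measurableSet_Iic, hset,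
    setIntegral_const, smul_eq_mul, mul_one, measureReal_def, StieltjesFunction.measure_Ioc]
  simp [CountingProcess.path, Nc.zero']

lemma buffer_thresholdPolicy (ts : ℝ≥0∞) (D : ℝ) (t : ℝ≥0) (ω : Ω) :
    buffer N Nc (thresholdPolicy ts) D t ω =
      D + N t ω + Nc (min (t : ℝ≥0∞) ts).toNNReal ω - t := by
  rw [buffer, setIntegral_thresholdPolicy]

lemma finishTime_top (u : OfflinePolicy) (D : ℝ) (ω : Ω) : finishTime ⊤ N Nc u D ω = ⊤ := by
  simp only [finishTime, iInf_eq_top]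
  intro t ht
  rw [EReal.coe_ennreal_top, EReal.top_sub_coe, top_le_iff] at ht
  exact absurd ht (EReal.coe_ne_top _)

lemma emptyTime_lt_top_iff {u : OfflinePolicy} {D : ℝ} {ω : Ω} :
    emptyTime N Nc u D ω < ⊤ ↔ ∃ t, buffer N Nc u D t ω ≤ 0 := by
  simp [emptyTime, iInf_lt_iff]

end Buffer

end Streaming

/-! ### Union bound and choice of threshold -/

open Streaming in
theorem mainTheorem5 {Ω : Type*} [MeasurableSpace Ω] (P : MeasureTheory.Measure Ω)
    [MeasureTheory.IsProbabilityMeasure P]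
    (R₀ Rc R₁ : ℝ≥0) (hR₀ : 1 < R₀) (hRc : 0 < Rc) (hR₁ : R₁ = R₀ + Rc)
    (N Nc : Streaming.CountingProcess Ω) (hN : N.IsPoisson R₀ P) (hNc : Nc.IsPoisson Rc P)
    (hind : ProbabilityTheory.IndepFun (fun ω t => N t ω) (fun ω t => Nc t ω) P)
    (D ε : ℝ) (hDε : (D, ε) ∈ Streaming.region R₀ R₁)
    (ts : ℝ≥0∞) (hts : Streaming.tsStar R₀ R₁ D ε ≤ (ts : EReal)) :
    Streaming.IsFeasible P ⊤ N Nc D ε (Streaming.thresholdPolicy ts) := by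
  have hR₀' : (1 : ℝ) < R₀ := by exact_mod_cast hR₀
  have hRc' : (0 : ℝ) < Rc := by exact_mod_cast hRc
  have hR₁' : (R₁ : ℝ) = R₀ + Rc := by rw [hR₁, NNReal.coe_add]
  have hα₀ := rBar_pos hR₀'
  have hα₁ : 0 < rBar R₁ := rBar_pos (by linarith)
  have hγ₀ : rBar R₀ + R₀ * (Real.exp (-rBar R₀) - 1) = 0 := gammaFun_rBar (by linarith)
  have hγ₁ : rBar R₁ + R₁ * (Real.exp (-rBar R₁) - 1) = 0 := gammaFun_rBar (by linarith)
  obtain ⟨hε, hDlow, -⟩ := hDε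
  dsimp only at hε hDlow
  have hlow : Real.exp (-(rBar R₁) * D) ≤ ε := by
    rw [← Real.le_log_iff_exp_le hε]
    rw [one_div_mul_eq_div, div_le_iff₀ hα₁, one_div, Real.log_inv] at hDlow
    linarith
  -- Both servers forever: start `0`, costly clock at full speed.
  set A : Set Ω := {ω | ∃ r : ℝ≥0, (D + N (0 + r) ω + Nc (0 + 1 * r) ω - ((0 : ℝ≥0) + r) : ℝ) ≤ 0}
  have hPA : P A ≤ ENNReal.ofReal (Real.exp (-(rBar R₁) * D)) := by
    refine (measure_exists_le_zero_le hN hNc hind 0 1 hα₁.le D ?_).trans_eq ?_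
    · rw [NNReal.coe_one, one_mul, ← hR₁', hγ₁]
    · simp
  rw [IsFeasible, interruptionProb]
  simp only [finishTime_top, emptyTime_lt_top_iff, buffer_thresholdPolicy]
  refine ENNReal.toReal_le_of_le_ofReal hε.le ?_
  have hearly : ∀ (ω : Ω) (t : ℝ≥0), (t : ℝ≥0∞) ≤ ts →
      (D + N t ω + Nc (min (t : ℝ≥0∞) ts).toNNReal ω - t : ℝ) ≤ 0 → ω ∈ A := by
    intro ω t htts h
    rw [min_eq_left htts, ENNReal.toNNReal_coe] at h
    exact ⟨t, by simpa using h⟩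
  induction ts with
  | top =>
    refine (measure_mono ?_).trans (hPA.trans (ENNReal.ofReal_le_ofReal hlow))
    rintro ω ⟨t, ht⟩
    exact hearly ω t le_top ht
  | coe a =>
    have hlt : Real.exp (-(rBar R₁) * D) < ε := by
      by_contra h
      rw [tsStar, if_neg h, top_le_iff] at hts
      exact absurd hts (by simp)
    rw [tsStar, if_pos hlt, show (((a : ℝ≥0∞) : ℝ≥0∞) : EReal) = ((a : ℝ) : EReal) from rfl,
      EReal.coe_le_coe_iff] at hts
    -- Speed `κ = 0` freezes the costly count at its value at time `a`.
    have hPB := measure_exists_le_zero_le hN hNc hind a 0 hα₀.le D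
      (by rw [NNReal.coe_zero, zero_mul, add_zero, hγ₀])
    have hexp : Real.exp (-rBar R₀ * D + rBar R₀ * a +
        (R₀ + Rc) * a * (Real.exp (-rBar R₀) - 1)) ≤ ε - Real.exp (-(rBar R₁) * D) := by
      rw [← Real.le_log_iff_exp_le (sub_pos.2 hlt)]
      rw [show (R₁ : ℝ) - R₀ = Rc by linarith, one_div (ε - _), Real.log_inv, div_mul_eq_mul_div,
        div_le_iff₀ hRc', one_div_mul_eq_div] at hts
      set l := Real.log (ε - Real.exp (-(rBar R₁) * D))
      set α := rBar R₀
      -- The root equation makes the exponent linear in `α`.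
      have hx : Real.exp (-α) - 1 = -α / R₀ := by
        rw [eq_div_iff (by positivity)]
        linarith
      have h2 : -l ≤ (D + a * Rc / R₀) * α := by
        rw [← div_le_iff₀ hα₀, ← sub_le_iff_le_add', le_div_iff₀ (by positivity)]
        linarith
      rw [hx]
      have h3 : -α * D + α * a + (R₀ + Rc) * a * (-α / R₀) = -((D + a * Rc / R₀) * α) := by
        field_simp
        ring
      linarith
    refine (measure_mono (t := A ∪ _) ?_).trans ((measure_union_le _ _).trans
      ((add_le_add hPA (hPB.trans (ENNReal.ofReal_le_ofReal hexp))).trans_eq ?_))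
    · rintro ω ⟨t, ht⟩
      rcases le_total t a with h | h
      · exact .inl (hearly ω t (ENNReal.coe_le_coe.2 h) ht)
      · refine .inr ⟨t - a, ?_⟩
        rw [min_eq_right (ENNReal.coe_le_coe.2 h), ENNReal.toNNReal_coe] at ht
        rw [add_tsub_cancel_of_le h, zero_mul, add_zero, NNReal.coe_sub h]
        linarith
    · rw [← ENNReal.ofReal_add (Real.exp_pos _).le (sub_pos.2 hlt).le]
      congr 1
      ring
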